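/- \textbf{Theorem} (alternate framework for persistent homology). Let $\mathbb F$ be a field. Call a diagram \emph{tempered} if all but finitely many of its arrows are isomorphisms. Let $\mathcal C$ be the category of complexes, i.e. tempered $\mathbb Z$-indexed chain complexes of finite-dimensional $\mathbb F$-vector spaces. Let $\mathcal F$ be the category of filtered complexes, i.e. diagrams $\cdots\to {}_{p-1}V_\bullet\to {}_pV_\bullet\to {}_{p+1}V_\bullet\to\cdots$ $(p\in\mathbb Z)$ in $\mathcal C$ that are tempered, bounded below (${}_pV_\bullet=0$ for all $p\le j$, for some $j\in\mathbb Z$), and have monic arrows. Let $\mathcal P$ be the category of tempered persistence vector spaces, i.e. tempered $\mathbb Z$-indexed diagrams $\cdots\to {}_{p-1}X\to {}_pX\to {}_{p+1}X\to\cdots$ of finite-dimensional $\mathbb F$-vector spaces. Morphisms in $\mathcal F$ and $\mathcal P$ are morphisms of diagrams. For $n\in\mathbb Z$ let $P_n:\mathcal F\to\mathcal P$ be the degree-$n$ persistent homology functor, obtained by applying the homology functor $H_n$ to a filtered complex levelwise. Let $\mathrm{coim}\,P_n$ be the quotient category of $\mathcal F$ by the congruence $f\sim f'\iff P_n(f)=P_n(f')$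 on parallel morphisms, and let $\mathrm{im}\,P_n$ be the full subcategory of $\mathcal P$ consisting of the tempered persistence vector spaces that are bounded below (${}_pX=0$ for all $p\le j$, for some $j\in\mathbb Z$). Then for every $n\in\mathbb Z$ the functor $P_n$ factors as $$\mathcal F\to \mathrm{coim}\,P_n\to \mathrm{im}\,P_n\to\mathcal P,$$ where the first functor is the quotient functor, the last is the inclusion, and the functor $\mathrm{coim}\,P_n\to\mathrm{im}\,P_n$ is an equivalence of categories. -/

import Mathlib

open CategoryTheory CategoryTheory.Limits

universe u

namespace PersHom

noncomputable section

section Diagrams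

variable {A : Type*} [Category A]

/-- A `ℤ`-indexed diagram `⋯ ⟶ X (p-1) ⟶ X p ⟶ X (p+1) ⟶ ⋯` (a functor from the poset `ℤ`) is
tempered if all but finitely many of its arrows `X p ⟶ X (p+1)` are isomorphisms. -/
def IsTempered : ObjectProperty (ℤ ⥤ A) := fun X =>
  {p : ℤ | ¬ IsIso (X.map (homOfLE (Int.le_add_one (le_refl p))))}.Finite

/-- A `ℤ`-indexed diagram is bounded below if there is `j` with `X p = 0` for all `p ≤ j`. -/
def IsBoundedBelow : ObjectProperty (ℤ ⥤ A) := fun X =>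
  ∃ j : ℤ, ∀ p : ℤ, p ≤ j → IsZero (X.obj p)

/-- A filtered object: a tempered, bounded below `ℤ`-indexed diagram with monic arrows. -/
def IsFilteredObject : ObjectProperty (ℤ ⥤ A) := fun X =>
  IsTempered X ∧ IsBoundedBelow X ∧
    ∀ p : ℤ, Mono (X.map (homOfLE (Int.le_add_one (le_refl p))))

/-- A functor preserves temperedness of diagrams. -/
lemma IsTempered.comp {B : Type*} [Category B] {X : ℤ ⥤ A} (hX : IsTempered X) (G : A ⥤ B) :
    IsTempered (X ⋙ G) := by
  refine Set.Finite.subset hX fun p hp hiso => hp ?_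
  have : IsIso (X.map (homOfLE (Int.le_add_one (le_refl p)))) := hiso
  exact inferInstanceAs (IsIso (G.map (X.map (homOfLE (Int.le_add_one (le_refl p))))))

end Diagrams

variable (k : Type u) [Field k]

/-- A chain complex `⋯ ⟵ V (n-1) ⟵ V n ⟵ V (n+1) ⟵ ⋯` of finite-dimensional vector spaces
is tempered if all but finitely many of its differentials are isomorphisms. (As the composite of
two successive differentials is zero, this forces `V n = 0` for all but finitely many `n`.) -/
def IsTemperedComplex : ObjectProperty (ChainComplex (FGModuleCat.{u} k) ℤ) := fun C =>
  {n : ℤ | ¬ IsIso (C.d (n + 1) n)}.Finite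

/-- The category of complexes: tempered `ℤ`-indexed chain complexes of finite-dimensional
`k`-vector spaces, with chain maps. -/
abbrev Cpx := (IsTemperedComplex k).FullSubcategory

/-- The homology functor `H n` from complexes to finite-dimensional `k`-vector spaces. -/
def homologyFunctor (n : ℤ) : Cpx k ⥤ FGModuleCat.{u} k :=
  (IsTemperedComplex k).ι ⋙
    HomologicalComplex.homologyFunctor (FGModuleCat.{u} k) (ComplexShape.down ℤ) n

/-- The category of filtered complexes. -/
abbrev FiltCpx := (IsFilteredObject (A := Cpx k)).FullSubcategory

/-- The category of tempered persistence vector spaces. -/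
abbrev Pers := (IsTempered (A := FGModuleCat.{u} k)).FullSubcategory

/-- The persistent homology functor `P n` of degree `n`, from filtered complexes to tempered
persistence vector spaces: apply `H n` to the whole diagram of complexes. -/
def persistentHomology (n : ℤ) : FiltCpx k ⥤ Pers k :=
  ObjectProperty.lift IsTempered
    ((IsFilteredObject (A := Cpx k)).ι ⋙ (Functor.whiskeringRight ℤ _ _).obj (homologyFunctor k n))
    (fun F => F.property.1.comp (homologyFunctor k n))

/-- The quotient of the category of filtered complexes by the congruence
`f ∼ f' ↔ P n f = P n f'`. -/
abbrev CoimP (n : ℤ) := CategoryTheory.Quotient (persistentHomology k n).homRel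

/-- The property of a tempered persistence vector space of being bounded below. -/
def IsBoundedBelowPers : ObjectProperty (Pers k) := fun X => IsBoundedBelow X.obj

/-- The full subcategory of the tempered persistence vector spaces on those which are bounded
below; it does not depend on the degree. -/
abbrev ImP := (IsBoundedBelowPers k).FullSubcategory

end

end PersHom

/-!
Persistent homology `P n` is full, and its essential image consists of the persistence vector
spaces that are bounded below. Once this is known, the functor induced on the quotient by the
congruence `P n f = P n f'` is full and essentially surjective, and it is faithful by construction.

Both facts rest on a projectivity statement, `IsMonicBoundedBelow.projective`: in the category of
`ℤ`-indexed diagrams of finite-dimensional vector spaces, a diagram with monic arrows that is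
bounded below is projective, since a lift along an epimorphism can be built step by step, splitting
off a complement at each step. Such diagrams are closed under subobjects. Hence, for a filtered
complex `F`, regarded as a chain complex of diagrams `F i`, all the subobjects of the `F i` (the
cycles, the boundaries, and `F i` modulo cycles) are projective.

*Fullness* (`exists_homologyMap_eq`). Let `α : H n F ⟶ H n G`. Projectivity of the cycles `Z n F`
gives a lift `ζ : Z n F ⟶ Z n G` of `α`, which maps boundaries to boundaries. Projectivity of the
boundaries gives a lift `B n F ⟶ G (n + 1)` of the restriction of `ζ`. As `F n / Z n F` is
projective, `ζ` extends to `F n ⟶ Z n G ⟶ G n`. These morphisms in degrees `n` and `n + 1`, together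
with zero in the other degrees, form a chain map which induces `α`. No decomposition of filtered
complexes into indecomposables is required.

*Essential surjectivity* (`exists_persistentHomology_iso`). A bounded below tempered persistence
vector space `X` receives an epimorphism `e` from a free one, `Q`, built from finitely many of the
spaces of `X`; both `Q` and the kernel of `e` are tempered and bounded below and have monic arrows.
The two-term complex `kernel e ⟶ Q` in degrees `n + 1` and `n` is a filtered complex, and its
homology in degree `n` is `X`.
-/

namespace PersHom

/-! ### Projective diagrams -/

section SplitDiagrams

variable {A : Type*} [Category A]

/-- The arrow `X p ⟶ X (p + 1)` of a `ℤ`-indexed diagram. -/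
noncomputable abbrev step (X : ℤ ⥤ A) (p : ℤ) : X.obj p ⟶ X.obj (p + 1) :=
  X.map (homOfLE (Int.le_add_one (le_refl p)))

lemma map_eq_comp_step (X : ℤ ⥤ A) {p q : ℤ} (h : p ≤ q) :
    X.map (homOfLE (h.trans (Int.le_add_one le_rfl))) = X.map (homOfLE h) ≫ step X q := by
  rw [← X.map_comp]
  rfl

lemma map_self (X : ℤ ⥤ A) {p : ℤ} (h : p ≤ p) : X.map (homOfLE h) = 𝟙 _ := X.map_id p

/-- A family of morphisms which is compatible with the arrows `p ⟶ p + 1` is natural. -/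
def natTransOfStep {X Y : ℤ ⥤ A} (φ : ∀ p, X.obj p ⟶ Y.obj p)
    (hφ : ∀ p, step X p ≫ φ (p + 1) = φ p ≫ step Y p) : X ⟶ Y where
  app := φ
  naturality := by
    suffices h : ∀ p q (h : p ≤ q), X.map (homOfLE h) ≫ φ q = φ p ≫ Y.map (homOfLE h) from
      fun p q f => h p q (leOfHom f)
    intro p q h
    induction q, h using Int.leInduction with
    | base => simp only [map_self, Category.comp_id, Category.id_comp]
    | succ q h ih =>
      rw [map_eq_comp_step X h, map_eq_comp_step Y h, Category.assoc, hφ, reassoc_of% ih]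

/-- A `ℤ`-indexed diagram that is bounded below and has monic arrows. -/
structure IsMonicBoundedBelow (X : ℤ ⥤ A) : Prop where
  bounded : IsBoundedBelow X
  mono : ∀ p, Mono (step X p)

lemma isZero_of_mono {X Y : A} [HasZeroMorphisms A] (i : X ⟶ Y) [Mono i] (hY : IsZero Y) :
    IsZero X := by
  rw [IsZero.iff_id_eq_zero, ← cancel_mono i]
  exact hY.eq_of_tgt _ _

lemma IsMonicBoundedBelow.of_mono [HasZeroMorphisms A] [HasPullbacks A] {X Y : ℤ ⥤ A}
    (hY : IsMonicBoundedBelow Y) (i : X ⟶ Y) [Mono i] : IsMonicBoundedBelow X where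
  bounded := by
    obtain ⟨j, hj⟩ := hY.bounded
    exact ⟨j, fun p hp => isZero_of_mono (i.app p) (hj p hp)⟩
  mono p := by
    have := hY.mono p
    have h : step X p ≫ i.app (p + 1) = i.app p ≫ step Y p := i.naturality _
    exact mono_of_mono_fac h

/-- A lift along `e` can be extended from `Q p` to `Q (p + 1)`: split the arrow
`Q p ⟶ Q (p + 1)`, keep the given lift on `Q p` and lift arbitrarily on the complement. -/
lemma exists_extend_lift [Preadditive A] [SplitEpiCategory A] [SplitMonoCategory A]
    {Q Q' M M' N N' : A} {i : Q ⟶ Q'} {m : M ⟶ M'} {n : N ⟶ N'} {e : M ⟶ N} {e' : M' ⟶ N'}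
    {f : Q ⟶ N} {f' : Q' ⟶ N'} [Mono i] [Epi e'] (hf : i ≫ f' = f ≫ n) (he : m ≫ e' = e ≫ n)
    (g : Q ⟶ M) (hg : g ≫ e = f) :
    ∃ g' : Q' ⟶ M', g' ≫ e' = f' ∧ i ≫ g' = g ≫ m := by
  have := isSplitMono_of_mono i
  have := isSplitEpi_of_epi e'
  refine ⟨retraction i ≫ g ≫ m + (𝟙 _ - retraction i ≫ i) ≫ f' ≫ section_ e', ?_, ?_⟩
  · simp [he, reassoc_of% hg, hf]
  · simp

/-- A diagram with monic arrows that is bounded below is projective, as soon as all monomorphisms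
and all epimorphisms of the target category split. -/
lemma IsMonicBoundedBelow.projective [Preadditive A] [HasPushouts A]
    [SplitEpiCategory A] [SplitMonoCategory A] {Q : ℤ ⥤ A} (hQ : IsMonicBoundedBelow Q) :
    Projective Q where
  factors {M N} f e _ := by
    obtain ⟨j, hj⟩ := hQ.bounded
    have ext (p : ℤ) (g : { g : Q.obj p ⟶ M.obj p // g ≫ e.app p = f.app p }) :
        ∃ g' : { g : Q.obj (p + 1) ⟶ M.obj (p + 1) // g ≫ e.app (p + 1) = f.app (p + 1) },
          step Q p ≫ g'.1 = g.1 ≫ step M p := by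
      have := hQ.mono p
      obtain ⟨g', h₁, h₂⟩ := exists_extend_lift (f.naturality (homOfLE (Int.le_add_one le_rfl)))
        (e.naturality (homOfLE (Int.le_add_one le_rfl))) g.1 g.2
      exact ⟨⟨g', h₁⟩, h₂⟩
    choose ext hext using ext
    -- the lift is zero up to degree `j`, and is then extended one degree at a time
    let g : ∀ p, { g : Q.obj p ⟶ M.obj p // g ≫ e.app p = f.app p } := fun p =>
      p.inductionOn' j ⟨0, (hj j le_rfl).eq_of_src _ _⟩ (fun p _ => ext p)
        (fun p hp _ => ⟨0, (hj (p - 1) (by lia)).eq_of_src _ _⟩)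
    refine ⟨natTransOfStep (fun p => (g p).1) fun p => ?_, ?_⟩
    · obtain hp | hp := le_or_gt j p
      · rw [show g (p + 1) = ext p (g p) from Int.inductionOn'_add_one hp]
        exact hext p _
      · exact (hj p hp.le).eq_of_src _ _
    · ext p
      exact (g p).2

end SplitDiagrams

/-! ### Lifting morphisms on homology in an abelian category -/

section Homology

variable {E : Type*} [Category E] [Abelian E]

/-- Let `X₁ ⟶ X₀ ⟶ Xₘ` and `Y₁ ⟶ Y₀ ⟶ Yₘ` be complexes with cycles `Z`, `Z'` and homology `H`, `H'`
in the middle, such that all subobjects of `X₀` and `Xₘ` are projective. A morphism `α : H ⟶ H'`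
lifts to `ζ : Z ⟶ Z'`; the restriction of `ζ` to the boundaries lifts to `Y₁`; and `ζ` extends to
`X₀` because `X₀ / Z`, a subobject of `Xₘ`, is projective, so that `Z` is a direct summand
of `X₀`. -/
lemma exists_lift_of_homology {X₁ Z X₀ Xₘ H Y₁ Z' Y₀ Yₘ H' : E}
    {c : X₁ ⟶ Z} {i : Z ⟶ X₀} {d : X₀ ⟶ Xₘ} {π : Z ⟶ H}
    {c' : Y₁ ⟶ Z'} {i' : Z' ⟶ Y₀} {d' : Y₀ ⟶ Yₘ} {π' : Z' ⟶ H'}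
    (h₀ : ∀ {W : E} (j : W ⟶ X₀) [Mono j], Projective W)
    (hₘ : ∀ {W : E} (j : W ⟶ Xₘ) [Mono j], Projective W)
    [Mono i] [Epi π'] (cπ : c ≫ π = 0) (w : i ≫ d = 0) (hid : (ShortComplex.mk i d w).Exact)
    (cπ' : c' ≫ π' = 0) (hcπ' : (ShortComplex.mk c' π' cπ').Exact) (w' : i' ≫ d' = 0)
    (α : H ⟶ H') :
    ∃ (ζ : Z ⟶ Z') (φ₁ : X₁ ⟶ Y₁) (φ₀ : X₀ ⟶ Y₀), π ≫ α = ζ ≫ π' ∧ i ≫ φ₀ = ζ ≫ i' ∧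
      φ₁ ≫ c' = c ≫ ζ ∧ φ₀ ≫ d' = 0 ∧ ∀ {W : E} (g : W ⟶ X₁), g ≫ c = 0 → g ≫ φ₁ = 0 := by
  have := h₀ i
  let ζ : Z ⟶ Z' := Projective.factorThru (π ≫ α) π'
  have hζ : ζ ≫ π' = π ≫ α := Projective.factorThru_comp _ _
  have := h₀ (image.ι c ≫ i)
  have hB : (image.ι c ≫ ζ) ≫ π' = 0 := by
    rw [← cancel_epi (factorThruImage c), Category.assoc, hζ, image.fac_assoc, reassoc_of% cπ,
      zero_comp, comp_zero]
  let β : image c ⟶ Y₁ := hcπ'.liftFromProjective (image.ι c ≫ ζ) hB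
  have hβ : β ≫ c' = image.ι c ≫ ζ := hcπ'.liftFromProjective_comp _ hB
  have hZ : i ≫ factorThruImage d = 0 := by
    rw [← cancel_mono (image.ι d), Category.assoc, image.fac, w, zero_comp]
  have hS : (ShortComplex.mk i (factorThruImage d) hZ).ShortExact :=
    { exact := by
        let Φ : ShortComplex.mk i (factorThruImage d) hZ ⟶ ShortComplex.mk i d w :=
          { τ₁ := 𝟙 _, τ₂ := 𝟙 _, τ₃ := image.ι d }
        have : Epi Φ.τ₁ := inferInstanceAs (Epi (𝟙 _))
        have : IsIso Φ.τ₂ := inferInstanceAs (IsIso (𝟙 _))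
        have : Mono Φ.τ₃ := inferInstanceAs (Mono (image.ι d))
        exact (ShortComplex.exact_iff_of_epi_of_isIso_of_mono Φ).2 hid
      mono_f := ‹Mono i›
      epi_g := inferInstanceAs (Epi (factorThruImage d)) }
  have := hₘ (image.ι d)
  let s := hS.splittingOfProjective
  have hr : i ≫ s.r = 𝟙 Z := s.f_r
  refine ⟨ζ, factorThruImage c ≫ β, s.r ≫ ζ ≫ i', hζ.symm, by rw [reassoc_of% hr], ?_, ?_, ?_⟩
  · rw [Category.assoc, hβ, image.fac_assoc]
  · simp only [Category.assoc, w', comp_zero]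
  · intro W g hg
    have : g ≫ factorThruImage c = 0 := by
      rw [← cancel_mono (image.ι c), Category.assoc, image.fac, hg, zero_comp]
    rw [reassoc_of% this, zero_comp]

end Homology

/-! ### Splitting in finite-dimensional vector spaces -/

section FiniteDimensional

variable (k : Type u) [Field k]

instance : SplitMonoCategory (FGModuleCat.{u} k) where
  isSplitMono_of_mono {V W} f _ := by
    have hf : Function.Injective f.hom.hom := (ModuleCat.mono_iff_injective _).1
      (inferInstanceAs (Mono ((forget₂ (FGModuleCat.{u} k) (ModuleCat.{u} k)).map f)))
    obtain ⟨r, hr⟩ := LinearMap.exists_leftInverse_of_injective _ (LinearMap.ker_eq_bot.2 hf)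
    exact .mk' ⟨FGModuleCat.ofHom r, FGModuleCat.hom_ext hr⟩

instance : SplitEpiCategory (FGModuleCat.{u} k) where
  isSplitEpi_of_epi {V W} f _ := by
    have hf : Function.Surjective f.hom.hom := (ModuleCat.epi_iff_surjective _).1
      (inferInstanceAs (Epi ((forget₂ (FGModuleCat.{u} k) (ModuleCat.{u} k)).map f)))
    obtain ⟨s, hs⟩ := LinearMap.exists_rightInverse_of_surjective _ (LinearMap.range_eq_top.2 hf)
    exact .mk' ⟨FGModuleCat.ofHom s, FGModuleCat.hom_ext hs⟩

end FiniteDimensional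

/-! ### Diagrams of chain complexes -/

section ComplexDiagrams

variable {J A : Type*} [Category J] [Category A] [Abelian A]

/-- Exactness in a category of functors is tested pointwise. -/
lemma exact_of_evaluation (S : ShortComplex (J ⥤ A))
    (h : ∀ j, (S.map ((evaluation J A).obj j)).Exact) : S.Exact := by
  rw [ShortComplex.exact_iff_isZero_homology]
  refine Functor.isZero _ fun j => ?_
  exact ((ShortComplex.exact_iff_isZero_homology _).1 (h j)).of_iso
    (S.mapHomologyIso ((evaluation J A).obj j)).symm

open HomologicalComplex

/-- The morphisms `K.toCycles (n + 1) n`, as a natural transformation. -/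
noncomputable def toCyclesNatTrans (n : ℤ) :
    eval A (ComplexShape.down ℤ) (n + 1) ⟶ cyclesFunctor A (ComplexShape.down ℤ) n where
  app K := K.toCycles (n + 1) n
  naturality K L f := by
    have : f.f (n + 1) ≫ L.toCycles (n + 1) n = K.toCycles (n + 1) n ≫ cyclesMap f n := by
      rw [← cancel_mono (L.iCycles n)]
      simp
    exact this

/-- The inclusions of the cycles, as a natural transformation. -/
noncomputable def iCyclesNatTrans (n : ℤ) :
    cyclesFunctor A (ComplexShape.down ℤ) n ⟶ eval A (ComplexShape.down ℤ) n where
  app K := K.iCycles n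
  naturality _ _ f := cyclesMap_i f n

/-- Morphisms in the degrees `n` and `n + 1` that are compatible with the differentials extend by
zero to a morphism of diagrams of chain complexes. -/
lemma exists_natTrans_of_two_degrees {F G : J ⥤ ChainComplex A ℤ} (n : ℤ)
    (φ₁ : F ⋙ eval _ _ (n + 1) ⟶ G ⋙ eval _ _ (n + 1)) (φ₀ : F ⋙ eval _ _ n ⟶ G ⋙ eval _ _ n)
    (h₂ : ∀ j, (F.obj j).d (n + 1 + 1) (n + 1) ≫ φ₁.app j = 0)
    (h₁ : ∀ j, φ₁.app j ≫ (G.obj j).d (n + 1) n = (F.obj j).d (n + 1) n ≫ φ₀.app j)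
    (h₀ : ∀ j, φ₀.app j ≫ (G.obj j).d n (n - 1) = 0) :
    ∃ φ : F ⟶ G, ∀ j, (φ.app j).f n = φ₀.app j := by
  classical
  let ψ : ∀ i : ℤ, F ⋙ eval _ _ i ⟶ G ⋙ eval _ _ i :=
    Function.update (Function.update (fun _ => 0) n φ₀) (n + 1) φ₁
  have ψ₁ : ψ (n + 1) = φ₁ := Function.update_self ..
  have ψ₀ : ψ n = φ₀ := by
    rw [show ψ n = _ from Function.update_of_ne (by lia) .., Function.update_self]
  have ψ' (i : ℤ) (hi : i ≠ n + 1) (hi' : i ≠ n) (j : J) :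
      (ψ i).app j = (0 : (F.obj j).X i ⟶ (G.obj j).X i) := by
    rw [show ψ i = _ from Function.update_of_ne hi .., Function.update_of_ne hi']
    rfl
  have comm (j : J) (i : ℤ) :
      (ψ (i + 1)).app j ≫ (G.obj j).d (i + 1) i = (F.obj j).d (i + 1) i ≫ (ψ i).app j := by
    by_cases hi : i = n
    · subst hi
      rw [ψ₁, ψ₀, h₁]
    by_cases hi' : i = n + 1
    · subst hi'
      rw [ψ₁, h₂, ψ' _ (by lia) (by lia)]
      exact zero_comp
    rw [ψ' i hi' hi]
    by_cases hi'' : i + 1 = n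
    · obtain rfl : i = n - 1 := by lia
      have key : ∀ m, m = n → (ψ m).app j ≫ (G.obj j).d m (n - 1) = 0 := by
        rintro m rfl
        rw [ψ₀, h₀]
      rw [key _ (by lia)]
      exact comp_zero.symm
    · rw [ψ' _ (by lia) (by lia)]
      exact zero_comp.trans comp_zero.symm
  refine ⟨{ app := fun j => { f := fun i => (ψ i).app j, comm' := ?_ }, naturality := ?_ }, ?_⟩
  · rintro _ i rfl
    exact comm j i
  · intro j j' f
    ext i
    exact (ψ i).naturality f
  · intro j
    exact congr_arg (fun φ => NatTrans.app φ j) ψ₀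

lemma comp_d_eq_of_cycles {K L : ChainComplex A ℤ} {n : ℤ} {φ₁ : K.X (n + 1) ⟶ L.X (n + 1)}
    {ζ : K.cycles n ⟶ L.cycles n} {φ₀ : K.X n ⟶ L.X n}
    (h₁ : φ₁ ≫ L.toCycles (n + 1) n = K.toCycles (n + 1) n ≫ ζ)
    (h₀ : K.iCycles n ≫ φ₀ = ζ ≫ L.iCycles n) :
    φ₁ ≫ L.d (n + 1) n = K.d (n + 1) n ≫ φ₀ := by
  rw [← L.toCycles_i, reassoc_of% h₁, ← h₀, toCycles_i_assoc]

lemma homologyMap_eq_of_cycles {K L : ChainComplex A ℤ} {n : ℤ} {φ : K ⟶ L}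
    {ζ : K.cycles n ⟶ L.cycles n} {α : K.homology n ⟶ L.homology n}
    (h₀ : K.iCycles n ≫ φ.f n = ζ ≫ L.iCycles n)
    (hζ : K.homologyπ n ≫ α = ζ ≫ L.homologyπ n) : homologyMap φ n = α := by
  have : cyclesMap φ n = ζ := by
    rw [← cancel_mono (L.iCycles n), cyclesMap_i, h₀]
  rw [← cancel_epi (K.homologyπ n), homologyπ_naturality, this, hζ]

/-- A morphism between the degree `n` homologies of two diagrams of chain complexes is induced by
a morphism of diagrams, if the first diagram consists of monic arrows and is bounded below in each
degree. -/
lemma exists_homologyMap_eq [SplitMonoCategory A] [SplitEpiCategory A]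
    {F G : ℤ ⥤ ChainComplex A ℤ} (hF : ∀ i, IsMonicBoundedBelow (F ⋙ eval _ _ i)) (n : ℤ)
    (α : F ⋙ HomologicalComplex.homologyFunctor A _ n ⟶
      G ⋙ HomologicalComplex.homologyFunctor A _ n) :
    ∃ φ : F ⟶ G, ∀ p, homologyMap (φ.app p) n = α.app p := by
  let c (K : ℤ ⥤ ChainComplex A ℤ) := Functor.whiskerLeft K (toCyclesNatTrans (A := A) n)
  let i (K : ℤ ⥤ ChainComplex A ℤ) := Functor.whiskerLeft K (iCyclesNatTrans (A := A) n)
  let d (K : ℤ ⥤ ChainComplex A ℤ) :=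
    Functor.whiskerLeft K (dNatTrans A (ComplexShape.down ℤ) n (n - 1))
  let π (K : ℤ ⥤ ChainComplex A ℤ) :=
    Functor.whiskerLeft K (natTransHomologyπ A (ComplexShape.down ℤ) n)
  have cπ (K) : c K ≫ π K = 0 := by
    ext p
    exact (K.obj p).toCycles_comp_homologyπ (n + 1) n
  have w (K) : i K ≫ d K = 0 := by
    ext p
    exact (K.obj p).iCycles_d n (n - 1)
  have : Mono (i F) := by
    rw [NatTrans.mono_iff_mono_app]
    exact fun p => inferInstanceAs (Mono ((F.obj p).iCycles n))
  have : Epi (π G) := by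
    rw [NatTrans.epi_iff_epi_app]
    exact fun p => inferInstanceAs (Epi ((G.obj p).homologyπ n))
  have hid : (ShortComplex.mk (i F) (d F) (w F)).Exact :=
    exact_of_evaluation _ fun p => ShortComplex.exact_of_f_is_kernel _
      ((F.obj p).cyclesIsKernel n (n - 1) (by simp))
  have hcπ : (ShortComplex.mk (c G) (π G) (cπ G)).Exact :=
    exact_of_evaluation _ fun p => ShortComplex.exact_of_g_is_cokernel _
      ((G.obj p).homologyIsCokernel (n + 1) n (by simp))
  obtain ⟨ζ, φ₁, φ₀, hζ, hφ₀, hφ₁, h₀, h₂⟩ := exists_lift_of_homology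
    (fun {W} j _ => ((hF n).of_mono j).projective)
    (fun {W} j _ => ((hF (n - 1)).of_mono j).projective)
    (cπ F) (w F) hid (cπ G) hcπ (w G) α
  have hdc : Functor.whiskerLeft F (dNatTrans A (ComplexShape.down ℤ) (n + 1 + 1) (n + 1)) ≫
      c F = 0 := by
    ext p
    exact (F.obj p).d_toCycles (n + 1 + 1) (n + 1) n
  obtain ⟨φ, hφ⟩ := exists_natTrans_of_two_degrees n φ₁ φ₀
    (fun p => NatTrans.congr_app (h₂ _ hdc) p)
    (fun p => comp_d_eq_of_cycles (NatTrans.congr_app hφ₁ p) (NatTrans.congr_app hφ₀ p))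
    (fun p => NatTrans.congr_app h₀ p)
  refine ⟨φ, fun p => homologyMap_eq_of_cycles (ζ := ζ.app p) ?_ (NatTrans.congr_app hζ p)⟩
  rw [hφ]
  exact NatTrans.congr_app hφ₀ p

end ComplexDiagrams

/-! ### Fullness of persistent homology -/

section Full

variable {k : Type u} [Field k]

/-- Two successive differentials that are both isomorphisms have composite zero, so that the spaces
they connect vanish. -/
lemma isTemperedComplex_iff (K : ChainComplex (FGModuleCat.{u} k) ℤ) :
    IsTemperedComplex k K ↔ {i : ℤ | ¬ IsZero (K.X i)}.Finite := by
  constructor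
  · intro hK
    refine (hK.union (hK.image (· + 1))).subset fun i hi => ?_
    by_contra h
    simp only [Set.mem_union, Set.mem_image, not_or, not_exists, not_and, Set.mem_ofPred_eq,
      not_not] at h
    obtain ⟨h₁, h₂⟩ := h
    refine hi ?_
    obtain ⟨j, rfl⟩ : ∃ j, i = j + 1 := ⟨i - 1, by lia⟩
    have h₃ : IsIso (K.d (j + 1) j) := by
      by_contra h
      exact h₂ j h rfl
    have : K.d (j + 1) j = 0 := by
      rw [← cancel_epi (K.d (j + 1 + 1) (j + 1)), K.d_comp_d, comp_zero]
    rw [IsZero.iff_id_eq_zero, ← cancel_mono (K.d (j + 1) j), this, comp_zero, comp_zero]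
  · intro hK
    refine (hK.union (hK.image (· - 1))).subset fun i hi => ?_
    by_contra h
    simp only [Set.mem_union, Set.mem_image, not_or, not_exists, not_and, Set.mem_ofPred_eq,
      not_not] at h
    have h₁ : IsZero (K.X (i + 1)) := by
      by_contra h'
      exact h.2 (i + 1) h' (by lia)
    exact hi (isIso_of_source_target_iso_zero _ h₁.isoZero h.1.isoZero)

lemma Cpx.isZero_iff (K : Cpx k) : IsZero K ↔ ∀ i, IsZero (K.obj.X i) := by
  constructor
  · intro hK i
    exact (HomologicalComplex.eval _ _ i).map_isZero ((IsTemperedComplex k).ι.map_isZero hK)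
  · intro h
    rw [IsZero.iff_id_eq_zero]
    apply ObjectProperty.hom_ext
    ext i : 1
    exact (h i).eq_of_src _ _

/-- A monomorphism of tempered complexes is a monomorphism in each degree: as the kernel, taken in
all chain complexes, is tempered, it vanishes. -/
lemma Cpx.mono_f {K L : Cpx k} (f : K ⟶ L) [Mono f] (i : ℤ) : Mono (f.hom.f i) := by
  have hW : IsTemperedComplex k (kernel f.hom) := by
    rw [isTemperedComplex_iff]
    refine ((isTemperedComplex_iff K.obj).1 K.property).subset fun i hi h => hi ?_
    exact isZero_of_mono ((kernel.ι f.hom).f i) h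
  let ι : (⟨kernel f.hom, hW⟩ : Cpx k) ⟶ K := ObjectProperty.homMk (kernel.ι f.hom)
  have hι : ι = 0 := by
    rw [← cancel_mono f, zero_comp]
    exact ObjectProperty.hom_ext _ (kernel.condition f.hom)
  have : Mono f.hom := by
    refine Preadditive.mono_of_kernel_zero ?_
    exact congr_arg (fun g => g.hom) hι
  infer_instance

lemma FiltCpx.isMonicBoundedBelow (F : FiltCpx k) (i : ℤ) :
    IsMonicBoundedBelow (F.obj ⋙ (IsTemperedComplex k).ι ⋙ HomologicalComplex.eval _ _ i) where
  bounded := by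
    obtain ⟨j, hj⟩ := F.property.2.1
    exact ⟨j, fun p hp => (Cpx.isZero_iff _).1 (hj p hp) i⟩
  mono p := by
    have := F.property.2.2 p
    exact Cpx.mono_f (F.obj.map (homOfLE (Int.le_add_one (le_refl p)))) i

instance (n : ℤ) : (persistentHomology k n).Full where
  map_surjective {F G} α := by
    obtain ⟨φ, hφ⟩ := exists_homologyMap_eq (F := F.obj ⋙ (IsTemperedComplex k).ι)
      (G := G.obj ⋙ (IsTemperedComplex k).ι) F.isMonicBoundedBelow n α.hom
    let ψ : F.obj ⟶ G.obj :=
      { app := fun p => ObjectProperty.homMk (φ.app p)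
        naturality := fun p q f => ObjectProperty.hom_ext _ (φ.naturality f) }
    refine ⟨ObjectProperty.homMk ψ, ?_⟩
    apply ObjectProperty.hom_ext
    ext p : 2
    exact hφ p

lemma persistentHomology_isBoundedBelow (n : ℤ) (F : FiltCpx k) :
    IsBoundedBelowPers k ((persistentHomology k n).obj F) := by
  obtain ⟨j, hj⟩ := F.property.2.1
  exact ⟨j, fun p hp => (HomologicalComplex.homologyFunctor _ _ n).map_isZero
    ((IsTemperedComplex k).ι.map_isZero (hj p hp))⟩

end Full

/-! ### Free persistence vector spaces -/

section Linear

variable {k : Type u} [Field k]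

lemma mono_of_injective {V W : FGModuleCat.{u} k} (f : V ⟶ W)
    (hf : Function.Injective f.hom.hom) : Mono f := by
  have : Mono ((forget₂ (FGModuleCat.{u} k) (ModuleCat.{u} k)).map f) :=
    (ModuleCat.mono_iff_injective f.hom).2 hf
  exact (forget₂ (FGModuleCat.{u} k) (ModuleCat.{u} k)).mono_of_mono_map this

lemma epi_of_surjective {V W : FGModuleCat.{u} k} (f : V ⟶ W)
    (hf : Function.Surjective f.hom.hom) : Epi f := by
  have : Epi ((forget₂ (FGModuleCat.{u} k) (ModuleCat.{u} k)).map f) :=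
    (ModuleCat.epi_iff_surjective f.hom).2 hf
  exact (forget₂ (FGModuleCat.{u} k) (ModuleCat.{u} k)).epi_of_epi_map this

lemma isZero_of_subsingleton (V : FGModuleCat.{u} k) [Subsingleton V] : IsZero V := by
  rw [IsZero.iff_id_eq_zero]
  ext x
  exact Subsingleton.elim (α := V) _ _

variable (X : ℤ ⥤ FGModuleCat.{u} k) (j N : ℤ)

/-- The `p`-th space of the free persistence vector space on the spaces `X q`, `j < q ≤ N`, each
placed in degree `q`: the families `(x q)` with `x q = 0` for `q > p`. -/
def freeSubmodule (p : ℤ) : Submodule k (∀ q : Finset.Ioc j N, X.obj q) where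
  carrier := {x | ∀ q : Finset.Ioc j N, p < q → x q = 0}
  add_mem' hx hy q hq := by rw [Pi.add_apply, hx q hq, hy q hq, add_zero]
  zero_mem' _ _ := rfl
  smul_mem' c x hx q hq := by rw [Pi.smul_apply, hx q hq, smul_zero]

lemma freeSubmodule_mono {p p' : ℤ} (h : p ≤ p') :
    freeSubmodule X j N p ≤ freeSubmodule X j N p' :=
  fun _ hx q hq => hx q (h.trans_lt hq)

/-- The free persistence vector space on the spaces `X q`, `j < q ≤ N`, each placed in degree
`q`. -/
noncomputable def freeDiagram : ℤ ⥤ FGModuleCat.{u} k where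
  obj p := FGModuleCat.of k (freeSubmodule X j N p)
  map f := FGModuleCat.ofHom (Submodule.inclusion (freeSubmodule_mono X j N (leOfHom f)))

/-- The linear map `X q ⟶ X p` of the diagram `X`, which is set to be `0` unless `q ≤ p`. -/
noncomputable def transition (q p : ℤ) : X.obj q →ₗ[k] X.obj p :=
  if h : q ≤ p then (X.map (homOfLE h)).hom.hom else 0

lemma map_transition {q p p' : ℤ} (h : q ≤ p) (h' : p ≤ p') (x : X.obj q) :
    (X.map (homOfLE h')).hom.hom (transition X q p x) = transition X q p' x := by
  rw [transition, transition, dif_pos h, dif_pos (h.trans h'), ← LinearMap.comp_apply,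
    ← FGModuleCat.hom_hom_comp, ← X.map_comp]
  rfl

/-- The sum of the transition maps of `X`, defined on families `(x q)`. -/
noncomputable def sumTransition (p : ℤ) : (∀ q : Finset.Ioc j N, X.obj q) →ₗ[k] X.obj p :=
  ∑ q : Finset.Ioc j N, transition X q p ∘ₗ LinearMap.proj q

/-- The canonical morphism from the free persistence vector space on the spaces `X q`. -/
noncomputable def freeDiagramTo : freeDiagram X j N ⟶ X where
  app p := FGModuleCat.ofHom (sumTransition X j N p ∘ₗ (freeSubmodule X j N p).subtype)
  naturality p p' f := by
    apply FGModuleCat.hom_ext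
    ext ⟨x, hx⟩
    change sumTransition X j N p' x = (X.map f).hom.hom (sumTransition X j N p x)
    simp only [sumTransition, LinearMap.sum_apply, map_sum, LinearMap.comp_apply,
      LinearMap.proj_apply]
    refine Finset.sum_congr rfl fun q _ => ?_
    by_cases hq : (q : ℤ) ≤ p
    · exact (map_transition X hq (leOfHom f) (x q)).symm
    · rw [hx q (not_le.1 hq)]
      simp only [map_zero]

lemma isMonicBoundedBelow_freeDiagram : IsMonicBoundedBelow (freeDiagram X j N) where
  bounded := by
    refine ⟨j, fun p hp => ?_⟩
    have : Subsingleton (freeSubmodule X j N p) := by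
      refine ⟨fun x y => Subtype.ext (funext fun q => ?_)⟩
      have hq : p < q := hp.trans_lt (Finset.mem_Ioc.1 q.2).1
      rw [x.2 q hq, y.2 q hq]
    exact @isZero_of_subsingleton _ _ ((freeDiagram X j N).obj p) this
  mono p := mono_of_injective _ (Submodule.inclusion_injective
    (freeSubmodule_mono X j N (Int.le_add_one le_rfl)))

/-- The arrow out of degree `p` is an isomorphism if no space is added in degree `p + 1`. -/
lemma isTempered_freeDiagram : IsTempered (freeDiagram X j N) := by
  refine (Set.finite_Ico j N).subset fun p hp => ?_
  by_contra h
  refine hp ?_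
  have := (isMonicBoundedBelow_freeDiagram X j N).mono p
  have : Epi (step (freeDiagram X j N) p) := by
    refine epi_of_surjective _ fun ⟨x, hx⟩ => ⟨⟨x, fun q hq => hx q ?_⟩, rfl⟩
    have := Finset.mem_Ioc.1 q.2
    simp only [Set.mem_Ico] at h
    lia
  exact isIso_of_mono_of_epi _

variable {X j N}

/-- In degrees `p ≤ N` the space `X p` is itself one of the generating spaces, unless it vanishes;
in degrees `p ≥ N` it is isomorphic to `X N`. -/
lemma epi_freeDiagramTo (hj : ∀ p ≤ j, IsZero (X.obj p)) (hjN : j < N)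
    (hN : ∀ p ≥ N, IsIso (step X p)) : Epi (freeDiagramTo X j N) := by
  rw [NatTrans.epi_iff_epi_app]
  have single (q p : ℤ) (hq : q ∈ Finset.Ioc j N) (hp : q ≤ p) (y : X.obj q) :
      (X.map (homOfLE hp)).hom.hom y ∈ Set.range ((freeDiagramTo X j N).app p).hom.hom := by
    have hy : Pi.single ⟨q, hq⟩ y ∈ freeSubmodule X j N p := by
      intro q' hq'
      refine Pi.single_eq_of_ne ?_ _
      rintro rfl
      exact hq'.not_ge hp
    refine ⟨⟨_, hy⟩, ?_⟩
    change sumTransition X j N p (Pi.single ⟨q, hq⟩ y) = _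
    simp only [sumTransition, LinearMap.sum_apply, LinearMap.comp_apply, LinearMap.proj_apply]
    rw [Finset.sum_eq_single ⟨q, hq⟩]
    · rw [Pi.single_eq_same, transition, dif_pos hp]
    · intro q' _ hq'
      rw [Pi.single_eq_of_ne hq', map_zero]
    · simp
  intro p
  obtain hp | hp := le_or_gt p j
  · have : IsSplitEpi ((freeDiagramTo X j N).app p) := .mk' ⟨0, (hj p hp).eq_of_src _ _⟩
    infer_instance
  obtain hp' | hp' := le_total p N
  · refine epi_of_surjective _ fun y => ?_
    have := single p p (Finset.mem_Ioc.2 ⟨hp, hp'⟩) le_rfl y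
    rwa [map_self] at this
  · have hiso : IsIso (X.map (homOfLE hp')) := by
      clear hp single
      induction p, hp' using Int.leInduction with
      | base => rw [map_self]; infer_instance
      | succ p hp ih =>
        have := hN p hp
        rw [map_eq_comp_step X hp]
        infer_instance
    refine epi_of_surjective _ fun y => ?_
    have := single N p (Finset.mem_Ioc.2 ⟨hjN, le_rfl⟩) hp' ((inv (X.map (homOfLE hp'))).hom.hom y)
    rwa [← LinearMap.comp_apply, ← FGModuleCat.hom_hom_comp, IsIso.inv_hom_id] at this

/-- A tempered persistence vector space which is bounded below is a quotient of a tempered one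
which is bounded below and has monic arrows. -/
lemma exists_epi_of_isTempered (hX : IsTempered X) (hX' : IsBoundedBelow X) :
    ∃ (Q : ℤ ⥤ FGModuleCat.{u} k) (e : Q ⟶ X), IsTempered Q ∧ IsMonicBoundedBelow Q ∧ Epi e := by
  obtain ⟨j, hj⟩ := hX'
  obtain ⟨N, hN⟩ := hX.bddAbove
  -- the upper bound exceeds `N`, so that all arrows above it are isomorphisms, and also `j`
  refine ⟨freeDiagram X j (max (N + 1) (j + 1)), freeDiagramTo X j _,
    isTempered_freeDiagram X j _, isMonicBoundedBelow_freeDiagram X j _,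
    epi_freeDiagramTo hj (by lia) fun p hp => ?_⟩
  by_contra h
  have : p ≤ N := hN h
  lia

end Linear

/-! ### Kernels of tempered diagrams -/

section Kernel

variable {A : Type*} [Category A] [Abelian A]

lemma isIso_τ₁_of_exact {S T : ShortComplex A} (φ : S ⟶ T) (hS : S.Exact) [Mono S.f] [Mono T.f]
    [IsIso φ.τ₂] [Mono φ.τ₃] : IsIso φ.τ₁ := by
  have h : (T.f ≫ inv φ.τ₂) ≫ S.g = 0 := by
    rw [← cancel_mono φ.τ₃, Category.assoc, Category.assoc, ← φ.comm₂₃, IsIso.inv_hom_id_assoc,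
      T.zero, zero_comp]
  have hs : hS.lift _ h ≫ φ.τ₁ = 𝟙 _ := by
    rw [← cancel_mono T.f, Category.assoc, φ.comm₁₂, hS.lift_f_assoc, Category.assoc,
      IsIso.inv_hom_id, Category.comp_id, Category.id_comp]
  refine ⟨hS.lift _ h, ?_, hs⟩
  rw [← cancel_mono S.f, Category.assoc, hS.lift_f, φ.comm₁₂_assoc, IsIso.hom_inv_id,
    Category.comp_id, Category.id_comp]

lemma isTempered_kernel {Q X : ℤ ⥤ A} (e : Q ⟶ X) (hQ : IsTempered Q) (hX : IsTempered X) :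
    IsTempered (kernel e) := by
  refine (hQ.union hX).subset fun p hp => ?_
  by_contra h
  simp only [Set.mem_union, not_or, Set.mem_ofPred_eq, not_not] at h
  obtain ⟨h₁, h₂⟩ := h
  refine hp ?_
  let S := ShortComplex.mk (kernel.ι e) e (kernel.condition e)
  have hS : S.Exact := ShortComplex.exact_of_f_is_kernel _ (kernelIsKernel e)
  let φ := S.mapNatTrans ((evaluation ℤ A).map (homOfLE (Int.le_add_one (le_refl p))))
  have : Mono (S.map ((evaluation ℤ A).obj p)).f := inferInstanceAs (Mono ((kernel.ι e).app p))
  have : Mono (S.map ((evaluation ℤ A).obj (p + 1))).f :=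
    inferInstanceAs (Mono ((kernel.ι e).app (p + 1)))
  have : IsIso φ.τ₂ := h₁
  have : IsIso φ.τ₃ := h₂
  exact isIso_τ₁_of_exact φ (hS.map ((evaluation ℤ A).obj p))

end Kernel

/-! ### Filtered complexes from complexes of diagrams -/

section Realization

open HomologicalComplex

variable {k : Type u} [Field k]

lemma Cpx.isIso_of_isIso_f {K L : Cpx k} (f : K ⟶ L) (h : ∀ i, IsIso (f.hom.f i)) :
    IsIso f := by
  have : IsIso ((IsTemperedComplex k).ι.map f) := Hom.isIso_of_components f.hom
  exact isIso_of_reflects_iso f (IsTemperedComplex k).ι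

/-- A complex of persistence vector spaces that is zero in almost all degrees, tempered in each
degree, bounded below uniformly in the degrees, and has monic arrows, is a filtered complex. -/
noncomputable def filtCpxOfComplex (C : ChainComplex (ℤ ⥤ FGModuleCat.{u} k) ℤ)
    (hC : {i | ¬ IsZero (C.X i)}.Finite) (ht : ∀ i, IsTempered (C.X i))
    (hb : ∃ j : ℤ, ∀ i, ∀ p ≤ j, IsZero ((C.X i).obj p)) (hm : ∀ i p, Mono (step (C.X i) p)) :
    FiltCpx k where
  obj := (IsTemperedComplex k).lift C.asFunctor fun p => by
    rw [isTemperedComplex_iff]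
    exact hC.subset fun i hi h => hi (((evaluation ℤ _).obj p).map_isZero h)
  property := by
    refine ⟨?_, ?_, fun p => ?_⟩
    · refine (hC.biUnion fun i _ => ht i).subset fun p hp => ?_
      by_contra h
      simp only [Set.mem_iUnion, not_exists, Set.mem_ofPred_eq, not_not] at h
      refine hp (Cpx.isIso_of_isIso_f _ fun i => ?_)
      by_cases hi : IsZero (C.X i)
      · exact isIso_of_source_target_iso_zero _
          (((evaluation ℤ _).obj p).map_isZero hi).isoZero
          (((evaluation ℤ _).obj (p + 1)).map_isZero hi).isoZero
      · exact h i hi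
    · obtain ⟨j, hj⟩ := hb
      exact ⟨j, fun p hp => (Cpx.isZero_iff _).2 fun i => hj i p hp⟩
    · refine (IsTemperedComplex k).ι.mono_of_mono_map ?_
      have := hm
      exact mono_of_mono_f _ fun i => hm i p

/-- The homology in degree `n` of a complex `K` whose differential `d n (n - 1)` vanishes is the
cokernel of `d (n + 1) n`. -/
lemma isIso_homologyι_comp_descOpcycles {A : Type*} [Category A] [Abelian A]
    (K : ChainComplex A ℤ) (n : ℤ) {X : A} (e : K.X n ⟶ X) [Epi e] (hd : K.d n (n - 1) = 0)
    (he : K.d (n + 1) n ≫ e = 0) (hex : (ShortComplex.mk _ _ he).Exact) :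
    IsIso (K.homologyι n ≫ K.descOpcycles e (n + 1) (by simp) he) := by
  have := K.isIso_homologyι n (n - 1) (by simp) hd
  have : Epi (ShortComplex.mk _ _ he).g := ‹Epi e›
  have h : K.descOpcycles e (n + 1) (by simp) he =
      (IsColimit.coconePointUniqueUpToIso (K.opcyclesIsCokernel (n + 1) n (by simp))
        hex.gIsCokernel).hom := by
    rw [← cancel_epi (K.pOpcycles n), p_descOpcycles]
    exact (IsColimit.comp_coconePointUniqueUpToIso_hom
      (K.opcyclesIsCokernel (n + 1) n (by simp)) hex.gIsCokernel WalkingParallelPair.one).symm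
  rw [h]
  infer_instance

end Realization

/-! ### Essential surjectivity of persistent homology -/

section EssSurj

open HomologicalComplex

variable {k : Type u} [Field k]

lemma IsTempered.of_iso {A : Type*} [Category A] {X Y : ℤ ⥤ A} (hX : IsTempered X) (e : X ≅ Y) :
    IsTempered Y := by
  refine hX.subset fun p hp h => hp ?_
  have : step Y p = e.inv.app p ≫ step X p ≫ e.hom.app (p + 1) := by simp
  have : IsIso (step X p) := h
  change IsIso (step Y p)
  rw [‹step Y p = _›]
  infer_instance

lemma isTempered_of_isZero {A : Type*} [Category A] [HasZeroMorphisms A] [HasZeroObject A]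
    {X : ℤ ⥤ A} (hX : IsZero X) : IsTempered X := by
  refine Set.finite_empty.subset fun p hp => hp ?_
  exact isIso_of_source_target_iso_zero _
    (((evaluation ℤ _).obj p).map_isZero hX).isoZero
    (((evaluation ℤ _).obj (p + 1)).map_isZero hX).isoZero

lemma homologyMap_comp_homologyι_comp_descOpcycles {A : Type*} [Category A] [Abelian A]
    {K L : ChainComplex A ℤ} {φ : K ⟶ L} {n : ℤ} {X Y : A} {e : K.X n ⟶ X} {e' : L.X n ⟶ Y}
    {f : X ⟶ Y} (he : K.d (n + 1) n ≫ e = 0) (he' : L.d (n + 1) n ≫ e' = 0)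
    (hn : (ComplexShape.down ℤ).prev n = n + 1) (h : φ.f n ≫ e' = e ≫ f) :
    homologyMap φ n ≫ L.homologyι n ≫ L.descOpcycles e' (n + 1) hn he' =
      (K.homologyι n ≫ K.descOpcycles e (n + 1) hn he) ≫ f := by
  rw [homologyι_naturality_assoc, opcyclesMap_comp_descOpcycles, Category.assoc,
    descOpcycles_comp]
  simp only [h]

/-- Every tempered persistence vector space that is bounded below is a persistent homology in
degree `n`, namely of a two-term filtered complex `kernel e ⟶ Q` for an epimorphism `e` from a
bounded below tempered diagram `Q` with monic arrows. -/
lemma exists_persistentHomology_iso (n : ℤ) (X : Pers k) (hX : IsBoundedBelowPers k X) :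
    ∃ F : FiltCpx k, Nonempty ((persistentHomology k n).obj F ≅ X) := by
  obtain ⟨Q, e, hQ, hQ', he⟩ := exists_epi_of_isTempered X.property hX
  have hrel : (ComplexShape.down ℤ).Rel (n + 1) n := rfl
  have hne : n + 1 ≠ n := by lia
  let C := double (kernel.ι e) hrel
  let e₁ : C.X (n + 1) ≅ kernel e := doubleXIso₀ _ _
  let e₀ : C.X n ≅ Q := doubleXIso₁ _ _ hne
  have hC (i : ℤ) (h₁ : i ≠ n + 1) (h₀ : i ≠ n) : IsZero (C.X i) :=
    isZero_double_X _ _ i h₁ h₀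
  -- in each degree, the complex embeds into `Q`
  have hCQ (i : ℤ) : ∃ f : C.X i ⟶ Q, Mono f := by
    by_cases h₁ : i = n + 1
    · subst h₁
      exact ⟨e₁.hom ≫ kernel.ι e, inferInstance⟩
    by_cases h₀ : i = n
    · subst h₀
      exact ⟨e₀.hom, inferInstance⟩
    exact ⟨0, ⟨fun _ _ _ => (hC i h₁ h₀).eq_of_tgt _ _⟩⟩
  let F := filtCpxOfComplex C
    ((Set.toFinite {n, n + 1}).subset fun i hi => by
      by_contra h
      simp only [Set.mem_insert_iff, Set.mem_singleton_iff, not_or] at h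
      exact hi (hC i h.2 h.1))
    (fun i => by
      by_cases h₁ : i = n + 1
      · subst h₁
        exact (isTempered_kernel e hQ X.property).of_iso e₁.symm
      by_cases h₀ : i = n
      · subst h₀
        exact hQ.of_iso e₀.symm
      exact isTempered_of_isZero (hC i h₁ h₀))
    (by
      obtain ⟨j, hj⟩ := hQ'.bounded
      refine ⟨j, fun i p hp => ?_⟩
      obtain ⟨f, _⟩ := hCQ i
      exact isZero_of_mono (f.app p) (hj p hp))
    (fun i p => by
      obtain ⟨f, _⟩ := hCQ i
      exact (hQ'.of_mono f).mono p)
  have hd : C.d (n + 1) n = e₁.hom ≫ kernel.ι e ≫ e₀.inv := double_d _ _ hne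
  have hd' : C.d n (n - 1) = 0 := double_d_eq_zero₀ _ _ _ _ (by lia)
  let g : C.X n ⟶ X.obj := e₀.hom ≫ e
  have hg : C.d (n + 1) n ≫ g = 0 := by simp [hd, g]
  have hex : (ShortComplex.mk _ _ hg).Exact := by
    have hker : (ShortComplex.mk _ _ (kernel.condition e)).Exact :=
      ShortComplex.exact_of_f_is_kernel _ (kernelIsKernel e)
    let iso : ShortComplex.mk _ _ (kernel.condition e) ≅ ShortComplex.mk _ _ hg :=
      ShortComplex.isoMk e₁.symm e₀.symm (Iso.refl _) (by simp [hd]) (by simp [g])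
    exact ShortComplex.exact_of_iso iso hker
  have : Epi g := epi_comp _ _
  have hgp (p : ℤ) : (C.asFunctor.obj p).d (n + 1) n ≫ g.app p = 0 := NatTrans.congr_app hg p
  let τ (p : ℤ) : (C.asFunctor.obj p).homology n ⟶ X.obj.obj p :=
    (C.asFunctor.obj p).homologyι n ≫
      (C.asFunctor.obj p).descOpcycles (g.app p) (n + 1) (by simp) (hgp p)
  have hτ (p : ℤ) : IsIso (τ p) := by
    have : Epi (X := (C.asFunctor.obj p).X n) (g.app p) :=
      (NatTrans.epi_iff_epi_app g).1 ‹Epi g› p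
    exact isIso_homologyι_comp_descOpcycles (C.asFunctor.obj p) n (g.app p)
      (NatTrans.congr_app hd' p) (hgp p) (hex.map ((evaluation ℤ _).obj p))
  have nat {p q : ℤ} (f : p ⟶ q) :
      homologyMap (C.asFunctor.map f) n ≫ τ q = τ p ≫ X.obj.map f := by
    exact homologyMap_comp_homologyι_comp_descOpcycles _ _ _ (g.naturality f)
  refine ⟨F, ⟨ObjectProperty.isoMk _ (NatIso.ofComponents (fun p => @asIso _ _ _ _ (τ p) (hτ p))
    fun f => nat f)⟩⟩

end EssSurj

/-! ### The induced functor on the quotient -/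

/-- The persistent homology functor, with values in the bounded below tempered persistence vector
spaces. -/
noncomputable def persistentHomologyToImP (k : Type u) [Field k] (n : ℤ) : FiltCpx k ⥤ ImP k :=
  (IsBoundedBelowPers k).lift (persistentHomology k n) (persistentHomology_isBoundedBelow n)

instance (k : Type u) [Field k] (n : ℤ) : (persistentHomologyToImP k n).Full :=
  inferInstanceAs ((IsBoundedBelowPers k).lift _ _).Full

instance (k : Type u) [Field k] (n : ℤ) : (persistentHomologyToImP k n).EssSurj where
  mem_essImage X := by
    obtain ⟨F, ⟨i⟩⟩ := exists_persistentHomology_iso n X.obj X.property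
    exact ⟨F, ⟨ObjectProperty.isoMk _ i⟩⟩

lemma homRel_persistentHomologyToImP (k : Type u) [Field k] (n : ℤ) :
    (persistentHomologyToImP k n).homRel = (persistentHomology k n).homRel := by
  funext F G f g
  exact propext ((IsBoundedBelowPers k).ι.map_injective.eq_iff
    (a := (persistentHomologyToImP k n).map f)).symm

lemma isEquivalence_quotientLift {C D : Type*} [Category C] [Category D] (L : C ⥤ D) [L.Full]
    [L.EssSurj] {r : HomRel C} (hr : L.homRel = r)
    (H : ∀ (x y : C) (f₁ f₂ : x ⟶ y), r f₁ f₂ → L.map f₁ = L.map f₂) :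
    (CategoryTheory.Quotient.lift r L H).IsEquivalence := by
  subst hr
  infer_instance

end PersHom

theorem mainTheorem6 (k : Type u) [Field k] (n : ℤ) :
    ∃ Φ : PersHom.CoimP k n ⥤ PersHom.ImP k,
      CategoryTheory.Quotient.functor (PersHom.persistentHomology k n).homRel ⋙ Φ ⋙
          (PersHom.IsBoundedBelowPers k).ι = PersHom.persistentHomology k n ∧
        Φ.IsEquivalence := by
  have h := PersHom.homRel_persistentHomologyToImP k n
  exact ⟨CategoryTheory.Quotient.lift _ (PersHom.persistentHomologyToImP k n)
    fun _ _ _ _ hfg => by rwa [← h] at hfg, rfl, PersHom.isEquivalence_quotientLift _ h _⟩
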